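/- Let $\mathbb K$ be an arbitrary field, $V=\mathbb K^\ell$, $S=\mathbb K[x_1,\dots,x_\ell]$, and let $\operatorname{Der}S=\bigoplus_{i}S\,\partial_{x_i}$ be the module of $\mathbb K$-linear derivations of $S$. An arrangement is a finite set $\mathcal B$ of linear hyperplanes of $V$. For each hyperplane $H$ fix a linear form $\alpha_H$ with kernel $H$, and put $$D(\mathcal B)=\{\theta\in\operatorname{Der}S\mid \theta(\alpha_H)\in S\alpha_H\text{ for all }H\in\mathcal B\}.$$ For $H\in\mathcal B$ let $\mathcal B^{H}=\{H\cap L\mid L\in\mathcal B\setminus\{H\}\}$. A derivation $\theta$ is homogeneous of degree $d$ if $\theta(\alpha)$ is zero or homogeneous of degree $d$ for every $\alpha\in V^*$. The arrangement $\mathcal B$ is free with exponents $(e_1,\dots,e_\ell)$ if the $S$-module $D(\mathcal B)$ has a basis $\theta_1,\dots,\theta_\ell$ with $\theta_i$ homogeneous of degree $e_i$. Let $\theta_E=\sum_i x_i\partial_{x_i}$ be the Euler derivation. **Theorem (Multiple addition theorem 2, MAT2).** Let $2\le q\le \ell$, and let $\mathcal A'$ be an arrangement in $V$ that is free with exponents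 $(1,d_2,\dots,d_\ell)$, where $1\le d_2\le\cdots\le d_\ell$. Let $H_q,\dots,H_\ell$ be linear hyperplanes of $V$, and put $\mathcal A=\mathcal A'\cup\{H_q,\dots,H_\ell\}$. Assume that 1. $|\mathcal A'|-|(\mathcal A'\cup\{H_j\})^{H_j}|=d_j$ for $j=q,\dots,\ell$; 2. $X=\bigcap_{j=q}^{\ell}H_j$ has codimension $\ell-q+1$ in $V$; 3. $X$ is contained in no hyperplane of $\mathcal A'$. Then $\mathcal A$ is free with exponents $(1,d_2,\dots,d_{q-1},d_q+1,\dots,d_\ell+1)$. Moreover, $D(\mathcal A')$ has an $S$-basis $\theta_E,\theta_2,\dots,\theta_{q-1},\eta_q,\dots,\eta_\ell$ such that $\theta_i$ is homogeneous of degree $d_i$ and $\theta_i\in D(\mathcal A)$ for $2\le i\le q-1$, and $\eta_j$ is homogeneous of degree $d_j$ and $\eta_j\in D(\mathcal A\setminus\{H_j\})$ for $q\le j\le \ell$. -/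

import Mathlib

namespace HypArr

/-- The ambient space `V = K^ℓ`. -/
abbrev V (K : Type*) [Field K] (ℓ : ℕ) : Type _ := Fin ℓ → K

/-- The coordinate ring `S = K[x_1, …, x_ℓ]` of `V`. -/
abbrev S (K : Type*) [Field K] (ℓ : ℕ) : Type _ := MvPolynomial (Fin ℓ) K

/-- `Der S`, the `S`-module of `K`-linear derivations of `S`. -/
abbrev Der (K : Type*) [Field K] (ℓ : ℕ) : Type _ := Derivation K (S K ℓ) (S K ℓ)

variable {K : Type*} [Field K] {ℓ : ℕ}

/-- The codimension of a linear subspace of `V`. -/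
noncomputable def codim (X : Submodule K (V K ℓ)) : ℕ :=
  Module.finrank K (V K ℓ ⧸ X)

/-- A linear hyperplane of `V`. -/
def IsHyperplane (H : Submodule K (V K ℓ)) : Prop := codim H = 1

/-- A (central) hyperplane arrangement in `V`: a finite set of linear hyperplanes. -/
structure IsArrangement (A : Set (Submodule K (V K ℓ))) : Prop where
  finite : A.Finite
  isHyperplane : ∀ H ∈ A, IsHyperplane H

/-- The restriction `A^H = {H ∩ L | L ∈ A \ {H}}`. -/
def restriction (A : Set (Submodule K (V K ℓ))) (H : Submodule K (V K ℓ)) :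
    Set (Submodule K (V K ℓ)) :=
  (fun L => H ⊓ L) '' (A \ {H})

/-- A linear form `α ∈ V*`, regarded as a polynomial of degree one in `S`. -/
noncomputable def linPoly (α : Module.Dual K (V K ℓ)) : S K ℓ :=
  ∑ i, MvPolynomial.C (α (Pi.single i 1)) * MvPolynomial.X i

/-- The logarithmic derivation module
`D(A) = {θ ∈ Der S | θ(α_H) ∈ S α_H for all H ∈ A}`, where `α_H` is a linear form with kernel `H`.
Any two such forms differ by a nonzero scalar, so the condition is imposed for all of them. -/
noncomputable def logDer (A : Set (Submodule K (V K ℓ))) : Submodule (S K ℓ) (Der K ℓ) where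
  carrier := {θ | ∀ H ∈ A, ∀ α : Module.Dual K (V K ℓ), LinearMap.ker α = H →
    θ (linPoly α) ∈ Ideal.span {linPoly α}}
  add_mem' := fun ha hb H hH α hα => by
    rw [Derivation.add_apply]
    exact add_mem (ha H hH α hα) (hb H hH α hα)
  zero_mem' := fun H _ α _ => by
    rw [Derivation.zero_apply]
    exact zero_mem _
  smul_mem' := fun c θ h H hH α hα => by
    rw [Derivation.smul_apply]
    exact Submodule.smul_mem _ c (h H hH α hα)

/-- `θ` is homogeneous of degree `d`: `θ(α)` is homogeneous of degree `d` for every `α ∈ V*`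
(the zero polynomial being homogeneous of every degree). -/
def IsHomogeneousDer (θ : Der K ℓ) (d : ℕ) : Prop :=
  ∀ α : Module.Dual K (V K ℓ), (θ (linPoly α)).IsHomogeneous d

/-- `A` is free with exponents `(d_1, …, d_ℓ)`: the `S`-module `D(A)` has a homogeneous basis
`θ_1, …, θ_ℓ` with `deg θ_i = d_i`. -/
def IsFreeWithExponents (A : Set (Submodule K (V K ℓ))) (d : Fin ℓ → ℕ) : Prop :=
  ∃ b : Module.Basis (Fin ℓ) (S K ℓ) (logDer A), ∀ i, IsHomogeneousDer (b i : Der K ℓ) (d i)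

/-- The Euler derivation `θ_E = ∑ x_i ∂_{x_i}`. -/
noncomputable def euler (K : Type*) [Field K] (ℓ : ℕ) : Der K ℓ :=
  MvPolynomial.mkDerivation K (fun i => MvPolynomial.X i)

end HypArr

namespace HypArr

open MvPolynomial

variable {K : Type*} [Field K] {ℓ : ℕ}

/-! Let `α k` be a form defining `H k` for the top indices `k`, those with `q ≤ k + 1`. Terao's
polynomial `b k` (`exists_restriction_polynomial`) satisfies `θ (α k) ≡ f * b k` modulo `α k` for
every `θ ∈ D(A')`, and by the counting hypothesis its degree is `d k`. A homogeneous basis `θ i`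
thus gives a matrix `F` with `θ i (α k) ≡ F i k * b k`, where `F i k` has degree `d i - d k`.

The core of the argument is that `F` has a nonzero maximal minor (`exists_det_coeff_ne_zero`). The
constant derivations dual to the `α k`, multiplied by the defining polynomial `Q` of `A'`, lie in
`D(A')`; expanding them in the basis and restricting to `X` gives `G F diag(b) = Q`, and `Q` does
not vanish on `X`. Since `d` is monotone and entries of negative degree are zero, the rows of this
minor can be moved to the top indices by a permutation preserving `d`. The block then has a
determinant of degree zero, hence a unit, and its graded inverse gives a basis `e` with `e i (α k) ≡
δ_ik b k` (`exists_adapted_basis`).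

As `α k` is prime and does not divide `b k`, an element of `D(A')` is tangent to `H k` exactly when
`α k` divides its `k`-th coordinate. Hence multiplying each `e k` by `α k` gives a basis of `D(A)`,
while `e` itself is the required basis of `D(A')` once the Euler derivation has been exchanged into
the first place. -/

/-! ### Linear forms as polynomials. -/

theorem linPoly_add (α β : Module.Dual K (V K ℓ)) : linPoly (α + β) = linPoly α + linPoly β := by
  simp [linPoly, add_mul, Finset.sum_add_distrib]

theorem linPoly_smul (c : K) (α : Module.Dual K (V K ℓ)) : linPoly (c • α) = C c * linPoly α := by
  simp [linPoly, Finset.mul_sum, mul_assoc]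

/-- `linPoly` as a linear map. -/
noncomputable def linPolyHom (K : Type*) [Field K] (ℓ : ℕ) :
    Module.Dual K (V K ℓ) →ₗ[K] S K ℓ where
  toFun := linPoly
  map_add' := linPoly_add
  map_smul' c α := by simp [linPoly_smul, smul_eq_C_mul]

theorem linPoly_sub (α β : Module.Dual K (V K ℓ)) : linPoly (α - β) = linPoly α - linPoly β :=
  map_sub (linPolyHom K ℓ) α β

@[simp]
theorem linPoly_zero : linPoly (0 : Module.Dual K (V K ℓ)) = 0 :=
  map_zero (linPolyHom K ℓ)

theorem linPoly_sum {ι : Type*} (s : Finset ι) (f : ι → Module.Dual K (V K ℓ)) :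
    linPoly (∑ i ∈ s, f i) = ∑ i ∈ s, linPoly (f i) :=
  map_sum (linPolyHom K ℓ) f s

@[simp]
theorem linPoly_proj (i : Fin ℓ) :
    linPoly (LinearMap.proj i : Module.Dual K (V K ℓ)) = X i := by
  classical
  simp [linPoly, Pi.single_apply]

theorem isHomogeneous_linPoly (α : Module.Dual K (V K ℓ)) : (linPoly α).IsHomogeneous 1 :=
  IsHomogeneous.sum _ _ _ fun _ _ => isHomogeneous_C_mul_X _ _

theorem dual_eq_sum (α : Module.Dual K (V K ℓ)) :
    α = ∑ i, α (Pi.single i 1) • (LinearMap.proj i : Module.Dual K (V K ℓ)) := by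
  classical
  refine LinearMap.pi_ext' fun i => LinearMap.ext_ring ?_
  simp [Pi.single_apply]

theorem eval_linPoly (v : V K ℓ) (α : Module.Dual K (V K ℓ)) : eval v (linPoly α) = α v := by
  conv_rhs => rw [dual_eq_sum α]
  simp [linPoly]

theorem linPoly_injective :
    Function.Injective (linPoly : Module.Dual K (V K ℓ) → S K ℓ) := fun α β h => by
  refine LinearMap.ext fun v => ?_
  rw [← eval_linPoly, h, eval_linPoly]

theorem linPoly_eq_zero {α : Module.Dual K (V K ℓ)} : linPoly α = 0 ↔ α = 0 :=
  ⟨fun h => linPoly_injective (h.trans linPoly_zero.symm), fun h => h ▸ linPoly_zero⟩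

/-! ### Restriction to a hyperplane, realised as composition with a projection. -/

/-- The algebra endomorphism of `S` given by composition of polynomial functions with `p`. -/
noncomputable def pullback (p : V K ℓ →ₗ[K] V K ℓ) : S K ℓ →ₐ[K] S K ℓ :=
  aeval fun i => linPoly (LinearMap.proj i ∘ₗ p)

theorem pullback_linPoly (p : V K ℓ →ₗ[K] V K ℓ) (α : Module.Dual K (V K ℓ)) :
    pullback p (linPoly α) = linPoly (α ∘ₗ p) := by
  have h : α ∘ₗ p = ∑ i, α (Pi.single i 1) • (LinearMap.proj i ∘ₗ p) := by
    refine LinearMap.ext fun v => ?_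
    conv_lhs => rw [dual_eq_sum α]
    simp
  rw [h, linPoly_sum]
  simp [linPoly, pullback, Finset.mul_sum, mul_assoc]

/-- The projection of `V` onto the kernel of `α` along `w`. -/
noncomputable def kerProj (α : Module.Dual K (V K ℓ)) (w : V K ℓ) : V K ℓ →ₗ[K] V K ℓ :=
  LinearMap.id - α.smulRight w

theorem kerProj_apply (α : Module.Dual K (V K ℓ)) (w v : V K ℓ) :
    kerProj α w v = v - α v • w := by
  simp [kerProj]

theorem comp_kerProj (α β : Module.Dual K (V K ℓ)) (w : V K ℓ) :
    β ∘ₗ kerProj α w = β - β w • α := by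
  refine LinearMap.ext fun v => ?_
  simp [kerProj_apply, mul_comm]

theorem kerProj_of_mem {α : Module.Dual K (V K ℓ)} (w : V K ℓ) {v : V K ℓ} (hv : α v = 0) :
    kerProj α w v = v := by
  simp [kerProj_apply, hv]

theorem comp_kerProj_self {α : Module.Dual K (V K ℓ)} {w : V K ℓ} (hw : α w = 1) :
    α ∘ₗ kerProj α w = 0 := by
  simp [comp_kerProj, hw]

theorem pullback_kerProj_self {α : Module.Dual K (V K ℓ)} {w : V K ℓ} (hw : α w = 1) :
    pullback (kerProj α w) (linPoly α) = 0 := by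
  rw [pullback_linPoly, comp_kerProj_self hw, linPoly_zero]

/-- Both the identity and the pullback are algebra maps, and they agree modulo `α` on the variables.
So the kernel of the pullback is the ideal generated by `α` when `α w = 1`; the pullback serves as
the quotient map, with values in the domain `S`. -/
theorem linPoly_dvd_sub_pullback (α : Module.Dual K (V K ℓ)) (w : V K ℓ) (u : S K ℓ) :
    linPoly α ∣ u - pullback (kerProj α w) u := by
  rw [← Ideal.mem_span_singleton, ← Ideal.Quotient.mk_eq_mk_iff_sub_mem]
  suffices h : Ideal.Quotient.mkₐ K (Ideal.span {linPoly α}) =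
      (Ideal.Quotient.mkₐ K (Ideal.span {linPoly α})).comp (pullback (kerProj α w)) from
    DFunLike.congr_fun h u
  refine MvPolynomial.algHom_ext fun i => ?_
  rw [AlgHom.comp_apply, ← linPoly_proj i, pullback_linPoly, comp_kerProj, linPoly_sub,
    linPoly_smul]
  simp only [Ideal.Quotient.mkₐ_eq_mk]
  rw [Ideal.Quotient.mk_eq_mk_iff_sub_mem, Ideal.mem_span_singleton]
  exact ⟨C (LinearMap.proj (φ := fun _ => K) i w), by ring⟩

theorem linPoly_dvd_iff {α : Module.Dual K (V K ℓ)} {w : V K ℓ} (hw : α w = 1) (u : S K ℓ) :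
    linPoly α ∣ u ↔ pullback (kerProj α w) u = 0 := by
  constructor
  · rintro ⟨c, rfl⟩
    rw [map_mul, pullback_kerProj_self hw, zero_mul]
  · intro h
    simpa [h] using linPoly_dvd_sub_pullback α w u

theorem exists_apply_eq_one {α : Module.Dual K (V K ℓ)} (h : α ≠ 0) : ∃ w, α w = 1 := by
  obtain ⟨v, hv⟩ : ∃ v, α v ≠ 0 := by
    by_contra! h'
    exact h (LinearMap.ext h')
  exact ⟨(α v)⁻¹ • v, by simp [hv]⟩

theorem prime_linPoly {α : Module.Dual K (V K ℓ)} (h : α ≠ 0) : Prime (linPoly α) := by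
  obtain ⟨w, hw⟩ := exists_apply_eq_one h
  refine ⟨fun h' => h (linPoly_eq_zero.1 h'), fun hu => ?_, fun a b hab => ?_⟩
  · have := hu.map (pullback (kerProj α w))
    rw [pullback_kerProj_self hw] at this
    exact not_isUnit_zero this
  · simp only [linPoly_dvd_iff hw, map_mul, mul_eq_zero] at hab ⊢
    exact hab

theorem exists_eq_smul_of_ker_le {α β : Module.Dual K (V K ℓ)}
    (h : LinearMap.ker α ≤ LinearMap.ker β) : ∃ c : K, β = c • α := by
  by_cases hα : α = 0
  · refine ⟨0, ?_⟩
    subst hα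
    rw [LinearMap.ker_zero, top_le_iff, LinearMap.ker_eq_top] at h
    simp [h]
  obtain ⟨w, hw⟩ := exists_apply_eq_one hα
  refine ⟨β w, sub_eq_zero.1 ?_⟩
  rw [← comp_kerProj]
  refine LinearMap.ext fun v => ?_
  exact h (show α (kerProj α w v) = 0 from DFunLike.congr_fun (comp_kerProj_self hw) v)

theorem ker_le_of_linPoly_dvd {α β : Module.Dual K (V K ℓ)} (h : linPoly α ∣ linPoly β) :
    LinearMap.ker α ≤ LinearMap.ker β := fun v hv => by
  have := map_dvd (eval v) h
  rw [eval_linPoly, eval_linPoly, LinearMap.mem_ker.1 hv, zero_dvd_iff] at this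
  exact this

theorem ker_eq_of_ker_le {α β : Module.Dual K (V K ℓ)} (hβ : β ≠ 0)
    (h : LinearMap.ker α ≤ LinearMap.ker β) : LinearMap.ker α = LinearMap.ker β := by
  obtain ⟨c, rfl⟩ := exists_eq_smul_of_ker_le h
  rw [LinearMap.ker_smul]
  rintro rfl
  simp at hβ

/-! ### Hyperplanes, their forms and logarithmic derivations. -/

theorem IsHyperplane.exists_dual {H : Submodule K (V K ℓ)} (h : IsHyperplane H) :
    ∃ α : Module.Dual K (V K ℓ), α ≠ 0 ∧ LinearMap.ker α = H := by
  unfold IsHyperplane codim at h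
  have e : (V K ℓ ⧸ H) ≃ₗ[K] K := LinearEquiv.ofFinrankEq _ _ (by simp [h])
  have hk : LinearMap.ker (e.toLinearMap ∘ₗ H.mkQ) = H := by
    rw [LinearEquiv.ker_comp, Submodule.ker_mkQ]
  refine ⟨e.toLinearMap ∘ₗ H.mkQ, fun h0 => ?_, hk⟩
  rw [h0, LinearMap.ker_zero] at hk
  subst hk
  rw [Module.finrank_zero_of_subsingleton] at h
  omega

theorem mem_logDer {A : Set (Submodule K (V K ℓ))} {θ : Der K ℓ} :
    θ ∈ logDer A ↔ ∀ α : Module.Dual K (V K ℓ), LinearMap.ker α ∈ A →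
      linPoly α ∣ θ (linPoly α) := by
  constructor
  · intro h α hα
    exact Ideal.mem_span_singleton.1 (h _ hα α rfl)
  · intro h H hH α hα
    exact Ideal.mem_span_singleton.2 (h α (hα ▸ hH))

theorem derivation_linPoly_smul (θ : Der K ℓ) (c : K) (α : Module.Dual K (V K ℓ)) :
    θ (linPoly (c • α)) = C c * θ (linPoly α) := by
  rw [linPoly_smul, ← smul_eq_C_mul, Derivation.map_smul, smul_eq_C_mul]

theorem linPoly_dvd_of_ker_eq {α β : Module.Dual K (V K ℓ)}
    (h : LinearMap.ker α = LinearMap.ker β) {θ : Der K ℓ}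
    (hθ : linPoly α ∣ θ (linPoly α)) : linPoly β ∣ θ (linPoly β) := by
  obtain ⟨c, rfl⟩ := exists_eq_smul_of_ker_le h.le
  rw [derivation_linPoly_smul, linPoly_smul]
  exact mul_dvd_mul_left _ hθ

theorem logDer_anti {A B : Set (Submodule K (V K ℓ))} (h : A ⊆ B) : logDer B ≤ logDer A :=
  fun _ hθ => mem_logDer.2 fun α hα => mem_logDer.1 hθ α (h hα)

theorem der_ext {θ η : Der K ℓ}
    (h : ∀ α : Module.Dual K (V K ℓ), θ (linPoly α) = η (linPoly α)) : θ = η :=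
  derivation_ext fun i => by simpa using h (LinearMap.proj i)

theorem euler_linPoly (α : Module.Dual K (V K ℓ)) : euler K ℓ (linPoly α) = linPoly α := by
  simp [linPoly, euler, mkDerivation_X, ← smul_eq_C_mul]

theorem euler_mem_logDer (A : Set (Submodule K (V K ℓ))) : euler K ℓ ∈ logDer A :=
  mem_logDer.2 fun α _ => (euler_linPoly α).symm ▸ dvd_rfl

/-- The directional derivative along `w`. -/
noncomputable def dirDeriv (w : V K ℓ) : Der K ℓ := mkDerivation K fun i => C (w i)

theorem dirDeriv_linPoly (w : V K ℓ) (α : Module.Dual K (V K ℓ)) :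
    dirDeriv w (linPoly α) = C (α w) := by
  conv_rhs => rw [dual_eq_sum α]
  simp [linPoly, dirDeriv, mkDerivation_X, ← smul_eq_C_mul]

open Classical in
/-- A chosen linear form with kernel `H`, for a hyperplane `H`. -/
noncomputable def form (H : Submodule K (V K ℓ)) : Module.Dual K (V K ℓ) :=
  if h : IsHyperplane H then h.exists_dual.choose else 0

theorem IsHyperplane.form_ne_zero {H : Submodule K (V K ℓ)} (h : IsHyperplane H) :
    form H ≠ 0 := by
  rw [form, dif_pos h]
  exact h.exists_dual.choose_spec.1

theorem IsHyperplane.ker_form {H : Submodule K (V K ℓ)} (h : IsHyperplane H) :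
    LinearMap.ker (form H) = H := by
  rw [form, dif_pos h]
  exact h.exists_dual.choose_spec.2

theorem isRelPrime_linPoly {α β : Module.Dual K (V K ℓ)} (hα : α ≠ 0) (hβ : β ≠ 0)
    (h : LinearMap.ker α ≠ LinearMap.ker β) : IsRelPrime (linPoly α) (linPoly β) :=
  (prime_linPoly hα).irreducible.isRelPrime_iff_not_dvd.2 fun hd =>
    h (ker_eq_of_ker_le hβ (ker_le_of_linPoly_dvd hd))

theorem prod_linPoly_form_dvd {s : Finset (Submodule K (V K ℓ))}
    (hs : ∀ H ∈ s, IsHyperplane H) {u : S K ℓ} (h : ∀ H ∈ s, linPoly (form H) ∣ u) :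
    ∏ H ∈ s, linPoly (form H) ∣ u := by
  refine Finset.prod_dvd_of_isRelPrime (fun H hH L hL hne => ?_) h
  have hH' := hs H hH
  have hL' := hs L hL
  refine isRelPrime_linPoly hH'.form_ne_zero hL'.form_ne_zero ?_
  rwa [hH'.ker_form, hL'.ker_form]

/-! ### Terao's polynomial. -/

theorem comp_kerProj_ne_zero {α β : Module.Dual K (V K ℓ)} {w : V K ℓ} (hβ : β ≠ 0)
    (h : LinearMap.ker α ≠ LinearMap.ker β) : β ∘ₗ kerProj α w ≠ 0 := fun h0 => by
  rw [comp_kerProj, sub_eq_zero] at h0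
  refine h (ker_eq_of_ker_le hβ fun v hv => ?_)
  rw [h0, LinearMap.mem_ker, LinearMap.smul_apply, LinearMap.mem_ker.1 hv, smul_zero]

theorem mem_ker_comp_kerProj {α β : Module.Dual K (V K ℓ)} {w v : V K ℓ} (hw : α w = 1) :
    v ∈ LinearMap.ker (β ∘ₗ kerProj α w) ↔
      kerProj α w v ∈ LinearMap.ker α ⊓ LinearMap.ker β := by
  have : α (kerProj α w v) = 0 := DFunLike.congr_fun (comp_kerProj_self hw) v
  simp [this]

theorem ker_inf_ker_comp_kerProj (α β : Module.Dual K (V K ℓ)) (w : V K ℓ) :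
    LinearMap.ker α ⊓ LinearMap.ker (β ∘ₗ kerProj α w) = LinearMap.ker α ⊓ LinearMap.ker β := by
  ext v
  simp only [Submodule.mem_inf, LinearMap.mem_ker, LinearMap.comp_apply]
  exact and_congr_right fun h => by rw [kerProj_of_mem w h]

/-- Two forms with the same trace on the hyperplane `ker α` are congruent modulo `α`, up to a
nonzero scalar. -/
theorem exists_comp_kerProj_eq_smul {α β γ : Module.Dual K (V K ℓ)} {w : V K ℓ} (hw : α w = 1)
    (hγ : γ ≠ 0) (hαγ : LinearMap.ker α ≠ LinearMap.ker γ)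
    (h : LinearMap.ker α ⊓ LinearMap.ker β = LinearMap.ker α ⊓ LinearMap.ker γ) :
    ∃ t : K, t ≠ 0 ∧ γ ∘ₗ kerProj α w = t • (β ∘ₗ kerProj α w) := by
  obtain ⟨t, ht⟩ := exists_eq_smul_of_ker_le (α := β ∘ₗ kerProj α w) (β := γ ∘ₗ kerProj α w)
    fun v hv => by
      rw [mem_ker_comp_kerProj hw] at hv ⊢
      rwa [← h]
  refine ⟨t, ?_, ht⟩
  rintro rfl
  rw [zero_smul] at ht
  exact comp_kerProj_ne_zero hγ hαγ ht

/-- The hypothesis means `γ = s • α + t • β`. The expression `β θ(α) - α θ(β)` is a two-by-two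
determinant, so replacing `β` by `γ` only multiplies it by `t`, and `γ` divides both terms of the
new determinant. -/
theorem linPoly_dvd_mul_sub_mul {α β γ : Module.Dual K (V K ℓ)} {w : V K ℓ} {t : K} (ht : t ≠ 0)
    (h : γ ∘ₗ kerProj α w = t • (β ∘ₗ kerProj α w)) {θ : Der K ℓ}
    (hθ : linPoly γ ∣ θ (linPoly γ)) :
    linPoly γ ∣ linPoly β * θ (linPoly α) - linPoly α * θ (linPoly β) := by
  obtain ⟨s, hs⟩ : ∃ s : K, γ = s • α + t • β := by
    refine ⟨γ w - t * β w, ?_⟩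
    refine LinearMap.ext fun v => ?_
    have hv := DFunLike.congr_fun h v
    simp only [comp_kerProj, LinearMap.sub_apply, LinearMap.smul_apply, LinearMap.add_apply,
      smul_eq_mul] at hv ⊢
    linear_combination hv
  have h1 : linPoly γ = C s * linPoly α + C t * linPoly β := by
    rw [hs, linPoly_add, linPoly_smul, linPoly_smul]
  have h2 : θ (linPoly γ) = C s * θ (linPoly α) + C t * θ (linPoly β) := by
    rw [hs, linPoly_add, map_add, derivation_linPoly_smul, derivation_linPoly_smul]
  have h3 : C t * (linPoly β * θ (linPoly α) - linPoly α * θ (linPoly β)) =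
      linPoly γ * θ (linPoly α) - linPoly α * θ (linPoly γ) := by
    rw [h2, h1]; ring
  have h4 : linPoly γ ∣ C t * (linPoly β * θ (linPoly α) - linPoly α * θ (linPoly β)) := by
    rw [h3]
    exact dvd_sub (dvd_mul_right _ _) (hθ.mul_left _)
  have hu : IsUnit (C t : S K ℓ) := (isUnit_iff_ne_zero.2 ht).map C
  exact hu.dvd_mul_left.1 h4

/-- The pairwise coprime forms of the members of `s` all divide `β θ(α) - α θ(β)`. On `ker α` the
second term vanishes and each of these forms becomes a scalar multiple of `β`, so `β ^ s.card`
divides `β θ(α)` there; one factor cancels. -/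
theorem pow_dvd_pullback_of_trace_eq {α β : Module.Dual K (V K ℓ)} {w : V K ℓ} (hw : α w = 1)
    (hβ : β ≠ 0) (hαβ : LinearMap.ker α ≠ LinearMap.ker β)
    {s : Finset (Submodule K (V K ℓ))} (hs : ∀ L ∈ s, IsHyperplane L)
    (hα : ∀ L ∈ s, LinearMap.ker α ≠ L)
    (h : ∀ L ∈ s, LinearMap.ker α ⊓ LinearMap.ker β = LinearMap.ker α ⊓ L) (hne : s.Nonempty)
    {θ : Der K ℓ} (hθ : ∀ L ∈ s, linPoly (form L) ∣ θ (linPoly (form L))) :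
    linPoly (β ∘ₗ kerProj α w) ^ (s.card - 1) ∣ pullback (kerProj α w) (θ (linPoly α)) := by
  have key : ∀ L ∈ s, ∃ t : K, t ≠ 0 ∧ form L ∘ₗ kerProj α w = t • (β ∘ₗ kerProj α w) := by
    intro L hL
    refine exists_comp_kerProj_eq_smul hw (hs L hL).form_ne_zero ?_ ?_
    · rw [(hs L hL).ker_form]; exact hα L hL
    · rw [(hs L hL).ker_form]; exact h L hL
  choose! t ht0 ht using key
  have hd : ∏ L ∈ s, linPoly (form L) ∣
      linPoly β * θ (linPoly α) - linPoly α * θ (linPoly β) :=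
    prod_linPoly_form_dvd hs fun L hL => linPoly_dvd_mul_sub_mul (ht0 L hL) (ht L hL) (hθ L hL)
  replace hd := map_dvd (pullback (kerProj α w)) hd
  rw [map_sub, map_mul, map_mul, pullback_kerProj_self hw, zero_mul, sub_zero, map_prod,
    Finset.prod_congr rfl fun L hL => by rw [pullback_linPoly, ht L hL, linPoly_smul],
    Finset.prod_mul_distrib, Finset.prod_const, pullback_linPoly] at hd
  replace hd := dvd_of_mul_left_dvd hd
  have h0 : linPoly (β ∘ₗ kerProj α w) ≠ 0 := fun h0 =>
    comp_kerProj_ne_zero hβ hαβ (linPoly_eq_zero.1 h0)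
  rw [← Nat.sub_add_cancel hne.card_pos, pow_succ', mul_dvd_mul_iff_left h0] at hd
  exact hd

/-- Terao's polynomial: if the hyperplane `ker α` is not in `A`, then `θ α` lies in the ideal
`(α, b)` for all `θ ∈ D(A)`, where `b` is homogeneous of degree `|A| - |A^H|`. -/
theorem exists_restriction_polynomial {A : Set (Submodule K (V K ℓ))} (hA : IsArrangement A)
    {α : Module.Dual K (V K ℓ)} (hα : α ≠ 0) (hαA : LinearMap.ker α ∉ A) :
    ∃ b : S K ℓ, b.IsHomogeneous (A.ncard -
        (restriction (A ∪ {LinearMap.ker α}) (LinearMap.ker α)).ncard) ∧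
      ¬ linPoly α ∣ b ∧ ∀ θ ∈ logDer A, ∃ h : S K ℓ, linPoly α ∣ θ (linPoly α) - h * b := by
  classical
  obtain ⟨w, hw⟩ := exists_apply_eq_one hα
  have hne : ∀ L ∈ A, LinearMap.ker α ≠ L := fun L hL h => hαA (h ▸ hL)
  set s := hA.finite.toFinset with hs
  have hsA : ∀ L, L ∈ s ↔ L ∈ A := fun L => hA.finite.mem_toFinset
  set r := s.image (LinearMap.ker α ⊓ ·) with hr
  have hres : restriction (A ∪ {LinearMap.ker α}) (LinearMap.ker α) = ↑r := by
    rw [restriction, Set.union_sdiff_right, Set.sdiff_singleton_eq_self hαA, hr, Finset.coe_image,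
      hs, Set.Finite.coe_toFinset]
  have hsec : ∀ Y ∈ r, ∃ L ∈ A, LinearMap.ker α ⊓ L = Y := by
    intro Y hY
    obtain ⟨L, hL, rfl⟩ := Finset.mem_image.1 hY
    exact ⟨L, (hsA L).1 hL, rfl⟩
  choose! ν hνA hν using hsec
  set f : Submodule K (V K ℓ) → Finset (Submodule K (V K ℓ)) :=
    fun Y => s.filter fun L => LinearMap.ker α ⊓ L = Y with hf
  have hform : ∀ Y ∈ r, LinearMap.ker (form (ν Y)) = ν Y := fun Y hY =>
    (hA.isHyperplane _ (hνA Y hY)).ker_form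
  have hneY : ∀ Y ∈ r, LinearMap.ker α ≠ LinearMap.ker (form (ν Y)) := fun Y hY => by
    rw [hform Y hY]; exact hne _ (hνA Y hY)
  have hform0 : ∀ Y ∈ r, form (ν Y) ≠ 0 := fun Y hY =>
    (hA.isHyperplane _ (hνA Y hY)).form_ne_zero
  have hcomp0 : ∀ Y ∈ r, form (ν Y) ∘ₗ kerProj α w ≠ 0 := fun Y hY =>
    comp_kerProj_ne_zero (hform0 Y hY) (hneY Y hY)
  have hfne : ∀ Y ∈ r, (f Y).Nonempty := fun Y hY =>
    ⟨ν Y, Finset.mem_filter.2 ⟨(hsA _).2 (hνA Y hY), hν Y hY⟩⟩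
  have hcard : ∑ Y ∈ r, ((f Y).card - 1) = s.card - r.card := by
    have h1 : s.card = ∑ Y ∈ r, (f Y).card :=
      Finset.card_eq_sum_card_fiberwise fun L hL => Finset.mem_image_of_mem _ hL
    have h2 : ∑ Y ∈ r, (f Y).card = ∑ Y ∈ r, ((f Y).card - 1) + r.card := by
      rw [Finset.card_eq_sum_ones, ← Finset.sum_add_distrib]
      exact Finset.sum_congr rfl fun Y hY => (Nat.sub_add_cancel (hfne Y hY).card_pos).symm
    omega
  -- Each trace `Y` on `ker α` contributes its form to the power one less than the number of members
  -- of `A` cutting it out; by `hcard` these exponents sum to `|A| - |A^H|`.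
  refine ⟨∏ Y ∈ r, linPoly (form (ν Y) ∘ₗ kerProj α w) ^ ((f Y).card - 1), ?_, ?_, ?_⟩
  · rw [hres, Set.ncard_coe_finset, Set.ncard_eq_toFinset_card _ hA.finite, ← hs, ← hcard]
    refine IsHomogeneous.prod _ _ _ fun Y _ => ?_
    simpa using (isHomogeneous_linPoly (form (ν Y) ∘ₗ kerProj α w)).pow ((f Y).card - 1)
  · intro hd
    obtain ⟨Y, hY, hd⟩ := (prime_linPoly hα).exists_mem_finset_dvd hd
    replace hd := ker_le_of_linPoly_dvd ((prime_linPoly hα).dvd_of_dvd_pow hd)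
    refine hneY Y hY (ker_eq_of_ker_le (hform0 Y hY) fun v hv => ?_)
    have h3 := hd hv
    rwa [LinearMap.mem_ker, LinearMap.comp_apply, kerProj_of_mem w (LinearMap.mem_ker.1 hv)] at h3
  · intro θ hθ
    have hd : ∏ Y ∈ r, linPoly (form (ν Y) ∘ₗ kerProj α w) ^ ((f Y).card - 1) ∣
        pullback (kerProj α w) (θ (linPoly α)) := by
      refine Finset.prod_dvd_of_isRelPrime (fun Y hY Z hZ hYZ => ?_) fun Y hY => ?_
      · refine IsRelPrime.pow (isRelPrime_linPoly (hcomp0 Y hY) (hcomp0 Z hZ) fun hk => hYZ ?_)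
        rw [← hν Y hY, ← hν Z hZ, ← hform Y hY, ← hform Z hZ,
          ← ker_inf_ker_comp_kerProj α _ w, hk, ker_inf_ker_comp_kerProj]
      · have hmem : ∀ L ∈ f Y, L ∈ A ∧ LinearMap.ker α ⊓ L = Y := fun L hL => by
          obtain ⟨h1, h2⟩ := Finset.mem_filter.1 hL
          exact ⟨(hsA L).1 h1, h2⟩
        refine pow_dvd_pullback_of_trace_eq hw (hform0 Y hY) (hneY Y hY)
          (fun L hL => hA.isHyperplane L (hmem L hL).1) (fun L hL => hne L (hmem L hL).1)
          (fun L hL => ?_) (hfne Y hY) fun L hL => mem_logDer.1 hθ _ ?_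
        · rw [hform Y hY, hν Y hY, (hmem L hL).2]
        · rw [(hA.isHyperplane L (hmem L hL).1).ker_form]
          exact (hmem L hL).1
    obtain ⟨h, hh⟩ := hd
    refine ⟨h, ?_⟩
    rw [mul_comm, ← hh]
    exact linPoly_dvd_sub_pullback α w _

/-! ### Homogeneity in integral degrees, where differences `d i - d j` may be negative. -/

section IntDegree

variable {σ R : Type*} [CommRing R]

/-- Homogeneity with respect to the `ℤ`-grading: only zero is homogeneous of negative degree. -/
def IsHomZ (p : MvPolynomial σ R) (z : ℤ) : Prop :=
  ∀ s, coeff s p ≠ 0 → (s.degree : ℤ) = z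

/-- The homogeneous component of integral degree `z`. -/
noncomputable def compZ (z : ℤ) (p : MvPolynomial σ R) : MvPolynomial σ R :=
  if 0 ≤ z then homogeneousComponent z.toNat p else 0

theorem coeff_compZ (z : ℤ) (p : MvPolynomial σ R) (s : σ →₀ ℕ) :
    coeff s (compZ z p) = if (s.degree : ℤ) = z then coeff s p else 0 := by
  unfold compZ
  by_cases hz : 0 ≤ z
  · rw [if_pos hz, coeff_homogeneousComponent]
    exact if_congr (by omega) rfl rfl
  · rw [if_neg hz, if_neg (by omega), coeff_zero]

theorem isHomZ_natCast {p : MvPolynomial σ R} {n : ℕ} : IsHomZ p n ↔ p.IsHomogeneous n := by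
  refine forall_congr' fun s => forall_congr' fun _ => ?_
  rw [Nat.cast_inj, Finsupp.degree_eq_weight_one]
  rfl

theorem isHomZ_zero (z : ℤ) : IsHomZ (0 : MvPolynomial σ R) z := fun s hs => by simp at hs

theorem isHomZ_one : IsHomZ (1 : MvPolynomial σ R) 0 :=
  isHomZ_natCast.2 (isHomogeneous_one σ R)

theorem IsHomZ.nonneg {p : MvPolynomial σ R} {z : ℤ} (h : IsHomZ p z) (hp : p ≠ 0) : 0 ≤ z := by
  obtain ⟨s, hs⟩ := ne_zero_iff.1 hp
  rw [← h s hs]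
  positivity

theorem isHomZ_compZ (z : ℤ) (p : MvPolynomial σ R) : IsHomZ (compZ z p) z := fun s hs => by
  by_contra h
  simp [coeff_compZ, h] at hs

theorem IsHomZ.compZ_eq {p : MvPolynomial σ R} {z : ℤ} (h : IsHomZ p z) : compZ z p = p := by
  ext s
  rw [coeff_compZ, ite_eq_left_iff]
  exact fun hs => (not_imp_comm.1 (h s) hs).symm

theorem compZ_add (p q : MvPolynomial σ R) (z : ℤ) :
    compZ z (p + q) = compZ z p + compZ z q := by
  ext t
  simp only [coeff_compZ, coeff_add]
  split_ifs <;> simp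

theorem compZ_sum {ι : Type*} (s : Finset ι) (f : ι → MvPolynomial σ R) (z : ℤ) :
    compZ z (∑ i ∈ s, f i) = ∑ i ∈ s, compZ z (f i) := by
  ext t
  simp only [coeff_compZ, coeff_sum]
  split_ifs <;> simp

/-- Only `q` has to be homogeneous. This allows arbitrary coefficients in a graded identity to be
replaced by their components of the expected degree. -/
theorem compZ_mul {p q : MvPolynomial σ R} {y : ℤ} (hq : IsHomZ q y) (z : ℤ) :
    compZ z (p * q) = compZ (z - y) p * q := by
  classical
  ext s
  rw [coeff_compZ, coeff_mul, coeff_mul]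
  have h0 : ∀ x ∈ Finset.HasAntidiagonal.antidiagonal s, coeff x.1 (compZ (z - y) p) * coeff x.2 q =
      if (s.degree : ℤ) = z then coeff x.1 p * coeff x.2 q else 0 := fun x hx => by
    by_cases hx0 : coeff x.2 q = 0
    · simp [hx0]
    have h1 := hq _ hx0
    have h2 : (s.degree : ℤ) = x.1.degree + x.2.degree := by
      rw [← Finset.HasAntidiagonal.mem_antidiagonal.1 hx, map_add, Nat.cast_add]
    rw [coeff_compZ, ite_mul, zero_mul]
    exact if_congr (by omega) rfl rfl
  rw [Finset.sum_congr rfl h0]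
  split_ifs <;> simp

theorem IsHomZ.mul {p q : MvPolynomial σ R} {y z : ℤ} (hp : IsHomZ p y) (hq : IsHomZ q z) :
    IsHomZ (p * q) (y + z) := by
  have := isHomZ_compZ (y + z) (p * q)
  rwa [compZ_mul hq, add_sub_cancel_right, hp.compZ_eq] at this

theorem IsHomZ.sum {ι : Type*} {s : Finset ι} {f : ι → MvPolynomial σ R} {z : ℤ}
    (h : ∀ i ∈ s, IsHomZ (f i) z) : IsHomZ (∑ i ∈ s, f i) z := by
  have := isHomZ_compZ z (∑ i ∈ s, f i)
  rwa [compZ_sum, Finset.sum_congr rfl fun i hi => (h i hi).compZ_eq] at this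

theorem IsHomZ.sub {p q : MvPolynomial σ R} {z : ℤ} (hp : IsHomZ p z) (hq : IsHomZ q z) :
    IsHomZ (p - q) z := fun s hs => by
  by_contra h
  have h1 := not_imp_comm.1 (hp s) h
  have h2 := not_imp_comm.1 (hq s) h
  simp [h1, h2] at hs

theorem IsHomZ.prod {ι : Type*} {s : Finset ι} {f : ι → MvPolynomial σ R} {z : ι → ℤ}
    (h : ∀ i ∈ s, IsHomZ (f i) (z i)) : IsHomZ (∏ i ∈ s, f i) (∑ i ∈ s, z i) := by
  classical
  induction s using Finset.induction_on with
  | empty => simpa using isHomZ_one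
  | insert a s ha ih =>
    rw [Finset.prod_insert ha, Finset.sum_insert ha]
    exact (h a (Finset.mem_insert_self a s)).mul
      (ih fun i hi => h i (Finset.mem_insert_of_mem hi))

/-- The determinant of a graded square matrix is homogeneous of degree zero. -/
theorem isHomZ_det {J : Type*} [Fintype J] [DecidableEq J] {F : Matrix J J (MvPolynomial σ R)}
    {d : J → ℤ} (h : ∀ i j, IsHomZ (F i j) (d i - d j)) : IsHomZ F.det 0 := by
  rw [Matrix.det_apply]
  refine IsHomZ.sum fun π _ => ?_
  have h1 : IsHomZ (∏ i, F (π i) i) 0 := by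
    have := IsHomZ.prod (s := Finset.univ) fun i _ => h (π i) i
    rwa [Finset.sum_sub_distrib, Equiv.sum_comp π d, sub_self] at this
  rcases Int.units_eq_one_or (Equiv.Perm.sign π) with h2 | h2
  · rwa [h2, one_smul]
  · rw [h2, Units.neg_smul, one_smul, ← zero_sub]
    exact (isHomZ_zero 0).sub h1

/-- A graded square matrix over a polynomial ring over a field with nonzero determinant has
a graded inverse. -/
theorem exists_graded_inverse {k J : Type*} [Field k] [Fintype J] [DecidableEq J]
    {F : Matrix J J (MvPolynomial σ k)} {d : J → ℤ} (h : ∀ i j, IsHomZ (F i j) (d i - d j))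
    (hdet : F.det ≠ 0) :
    ∃ G : Matrix J J (MvPolynomial σ k), G * F = 1 ∧ F * G = 1 ∧
      ∀ i j, IsHomZ (G i j) (d i - d j) := by
  have hu : IsUnit F.det := by
    have h0 : F.det.IsHomogeneous 0 := isHomZ_natCast.1 (isHomZ_det h)
    rw [← totalDegree_zero_iff_isHomogeneous, totalDegree_eq_zero_iff_eq_C] at h0
    rw [h0] at hdet ⊢
    exact (isUnit_iff_ne_zero.2 fun hc => hdet (by rw [hc, C_0])).map C
  -- Both `F` and the identity matrix are graded, so truncating the entries of `F⁻¹` to the expected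
  -- degrees preserves the left inverse identity.
  have hG : (Matrix.of fun i j => compZ (d i - d j) (F⁻¹ i j)) * F = 1 := by
    ext1 i j
    have h1 : ∑ l, F⁻¹ i l * F l j = (1 : Matrix J J (MvPolynomial σ k)) i j := by
      rw [← Matrix.mul_apply, Matrix.nonsing_inv_mul F hu]
    have h2 : IsHomZ ((1 : Matrix J J (MvPolynomial σ k)) i j) (d i - d j) := by
      rcases eq_or_ne i j with rfl | hij
      · simpa using isHomZ_one
      · simpa [hij] using isHomZ_zero _
    rw [Matrix.mul_apply, ← h2.compZ_eq, ← h1, compZ_sum]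
    refine Finset.sum_congr rfl fun l _ => ?_
    rw [compZ_mul (h l j), Matrix.of_apply]
    congr 2
    ring
  exact ⟨_, hG, mul_eq_one_comm.1 hG, fun i j => isHomZ_compZ _ _⟩

end IntDegree

/-! ### Minors, reindexing and bases. -/

/-- A weak form of the Cauchy-Binet formula. -/
theorem exists_det_submatrix_ne_zero {m n R : Type*} [Fintype m] [Fintype n] [DecidableEq n]
    [DecidableEq m] [CommRing R] {G : Matrix n m R} {F : Matrix m n R} (h : (G * F).det ≠ 0) :
    ∃ ρ : n → m, (F.submatrix ρ id).det ≠ 0 := by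
  by_contra! h0
  refine h ?_
  have h1 : G * F = fun i => ∑ k, G i k • F k := by
    ext i j
    simp [Matrix.mul_apply]
  rw [h1]
  -- Multilinearity in the rows writes the determinant as a combination of the determinants with
  -- rows `F (ρ i)`, over all maps `ρ`.
  have h2 := (Matrix.detRowAlternating (n := n) (R := R)).toMultilinearMap.map_sum
    (fun i k => G i k • F k)
  refine h2.trans (Finset.sum_eq_zero fun ρ _ => ?_)
  rw [MultilinearMap.map_smul_univ]
  exact (congrArg _ (h0 ρ)).trans (smul_zero _)

/-- An injection on a subtype that preserves `d` extends to a permutation that preserves `d`. -/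
theorem exists_perm_extend {ι α : Type*} [Fintype ι] {p : ι → Prop} (d : ι → α)
    (ρ : {i // p i} → ι) (hρ : Function.Injective ρ) (hd : ∀ i, d (ρ i) = d i) :
    ∃ π : Equiv.Perm ι, (∀ i : {i // p i}, π i = ρ i) ∧ ∀ i, d (π i) = d i := by
  classical
  -- Since `ρ` preserves `d`, it can be extended to a bijection on each fibre of `d` separately.
  have key : ∀ e : α, ∃ g : {i // d i = e} ≃ (Finset.univ.filter fun i => d i = e : Finset ι),
      ∀ i : {i // d i = e}, ∀ h : p i, (g i : ι) = ρ ⟨i, h⟩ := by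
    intro e
    obtain ⟨g, hg⟩ := Finset.exists_equiv_extend_of_card_eq (α := {i // d i = e})
      (t := Finset.univ.filter fun i => d i = e)
      (s := Finset.univ.filter fun i : {i // d i = e} => p i)
      (f := fun i => if h : p i then ρ ⟨i, h⟩ else i) (Fintype.card_subtype _) (by
        intro x hx
        obtain ⟨i, hi, rfl⟩ := Finset.mem_image.1 hx
        have hi' := (Finset.mem_filter.1 hi).2
        simp [hi', hd, i.2]) (by
        intro i hi j hj hij
        have hi' : p i := by simpa using hi
        have hj' : p j := by simpa using hj
        simp only [hi', hj', dif_pos] at hij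
        have := hρ hij
        exact Subtype.ext (by simpa using this))
    refine ⟨g, fun i h => ?_⟩
    rw [hg i (by simpa using h), dif_pos h]
  choose g hg using key
  have hgd : ∀ i, d (g (d i) ⟨i, rfl⟩ : ι) = d i := fun i =>
    (Finset.mem_filter.1 (g (d i) ⟨i, rfl⟩).2).2
  have hinj : Function.Injective fun i => (g (d i) ⟨i, rfl⟩ : ι) := by
    intro i j hij
    have hdij : d i = d j := by
      rw [← hgd i, ← hgd j]; exact congrArg d hij
    have hcongr : ∀ e (h : d i = e), (g (d i) ⟨i, rfl⟩ : ι) = g e ⟨i, h⟩ := by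
      rintro _ rfl; rfl
    have hij' : (g (d j) ⟨i, hdij⟩ : ι) = g (d j) ⟨j, rfl⟩ := by
      rw [← hcongr]; exact hij
    exact congrArg Subtype.val ((g (d j)).injective (Subtype.ext hij'))
  exact ⟨Equiv.ofBijective _ (Finite.injective_iff_bijective.1 hinj), fun i => hg _ _ i.2, hgd⟩

/-- The largest terms of a monotone sequence cannot be increased by an injective reindexing. -/
theorem apply_eq_of_injective_of_le {ℓ q : ℕ} {d : Fin ℓ → ℕ} (hd : Monotone d)
    {τ : {j : Fin ℓ // q ≤ (j : ℕ) + 1} → Fin ℓ} (hτ : Function.Injective τ)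
    (h : ∀ j : {j : Fin ℓ // q ≤ (j : ℕ) + 1}, d j ≤ d (τ j)) (j : {j : Fin ℓ // q ≤ (j : ℕ) + 1}) : d (τ j) = d j := by
  classical
  refine le_antisymm (not_lt.1 fun hlt => ?_) (h j)
  have hT : ∀ i : Fin ℓ, d j < d i → q ≤ (i : ℕ) + 1 := fun i hi => by
    have h1 : (j : Fin ℓ) < i := not_le.1 fun h2 => absurd (hd h2) (not_le.2 hi)
    have h2 := j.2
    have h3 : ((j : Fin ℓ) : ℕ) < i := h1
    omega
  set T := Finset.univ.filter fun i : {j : Fin ℓ // q ≤ (j : ℕ) + 1} => d j < d i with hTdef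
  have hjT : j ∉ T := by simp [hTdef]
  -- If `d j < d (τ j)`, then `τ` maps `T` and also `j` to indices with value above `d j`. By `hT`
  -- all such indices are top ones, so there are only `T.card` of them, contradicting injectivity.
  have hsub : (insert j T).image τ ⊆ T.image Subtype.val := by
    intro x hx
    obtain ⟨i, hi, rfl⟩ := Finset.mem_image.1 hx
    have hi' : d j < d (τ i) := by
      rcases Finset.mem_insert.1 hi with rfl | hi
      · exact hlt
      · exact (Finset.mem_filter.1 hi).2.trans_le (h i)
    exact Finset.mem_image.2 ⟨⟨τ i, hT _ hi'⟩, by simpa [hTdef] using hi', rfl⟩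
  have := Finset.card_le_card hsub
  rw [Finset.card_image_of_injective _ hτ, Finset.card_image_of_injective _
    Subtype.val_injective, Finset.card_insert_of_notMem hjT] at this
  omega

/-- A family that spans a free module of the same finite rank is a basis. -/
theorem exists_basis_eq_of_mem_span {ι R M : Type*} [Fintype ι] [CommRing R] [Nontrivial R]
    [AddCommGroup M] [Module R M] (b : Module.Basis ι R M) (v : ι → M)
    (h : ∀ i, b i ∈ Submodule.span R (Set.range v)) :
    ∃ b' : Module.Basis ι R M, ⇑b' = v := by
  have : Module.Finite R M := Module.Finite.of_basis b
  have hs : ⊤ ≤ Submodule.span R (Set.range v) := by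
    rw [← b.span_eq, Submodule.span_le]
    rintro _ ⟨i, rfl⟩
    exact h i
  exact ⟨basisOfTopLeSpanOfCardEqFinrank v hs (Module.finrank_eq_card_basis b).symm,
    coe_basisOfTopLeSpanOfCardEqFinrank v hs _⟩

/-! ### The coefficient matrix modulo the forms `α k` and its nonzero minor. -/

theorem isHomogeneousDer_iff {θ : Der K ℓ} {n : ℕ} :
    IsHomogeneousDer θ n ↔ ∀ α, IsHomZ (θ (linPoly α)) n :=
  forall_congr' fun _ => isHomZ_natCast.symm

theorem coe_sum_smul_apply {A : Set (Submodule K (V K ℓ))} {ι : Type*} (s : Finset ι)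
    (g : ι → S K ℓ) (θ : ι → logDer A) (u : S K ℓ) :
    ((∑ i ∈ s, g i • θ i : logDer A) : Der K ℓ) u = ∑ i ∈ s, g i * (θ i : Der K ℓ) u := by
  classical
  induction s using Finset.induction_on with
  | empty => simp
  | insert a s ha ih =>
    rw [Finset.sum_insert ha, Finset.sum_insert ha, Submodule.coe_add, Derivation.add_apply, ih]
    rfl

/-- Taking the component of degree `n` in `θ(α) = f * b + k * α` makes `f` homogeneous. When `n < m`
this forces `f = 0`, which later restricts the rows of a nonzero minor. -/
theorem exists_homogeneous_coeff {α : Module.Dual K (V K ℓ)} {θ : Der K ℓ} {n m : ℕ}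
    (hθ : IsHomogeneousDer θ n) {b : S K ℓ} (hb : b.IsHomogeneous m)
    (h : ∃ f : S K ℓ, linPoly α ∣ θ (linPoly α) - f * b) :
    ∃ f : S K ℓ, IsHomZ f ((n : ℤ) - m) ∧ linPoly α ∣ θ (linPoly α) - f * b := by
  obtain ⟨f, k, hk⟩ := h
  refine ⟨compZ (n - m) f, isHomZ_compZ _ _, compZ (n - 1) k, ?_⟩
  have h1 : θ (linPoly α) = f * b + k * linPoly α := by linear_combination hk
  have hα : IsHomZ (linPoly α) 1 := by
    exact_mod_cast isHomZ_natCast.2 (isHomogeneous_linPoly α)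
  have h2 := congrArg (compZ (n : ℤ)) h1
  rw [(isHomogeneousDer_iff.1 hθ α).compZ_eq, compZ_add, compZ_mul (isHomZ_natCast.2 hb),
    compZ_mul hα] at h2
  linear_combination h2

theorem iInf_ker_eq_ker_pi {J : Type*} (α : J → Module.Dual K (V K ℓ)) :
    ⨅ k, LinearMap.ker (α k) = LinearMap.ker (LinearMap.pi α) :=
  (LinearMap.ker_pi α).symm

/-- Linear forms whose common kernel has the expected codimension admit dual vectors. -/
theorem exists_dual_vectors {J : Type*} [Fintype J] [DecidableEq J]
    (α : J → Module.Dual K (V K ℓ)) (h : codim (⨅ k, LinearMap.ker (α k)) = Fintype.card J) :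
    ∃ w : J → V K ℓ, ∀ j k, α k (w j) = if j = k then 1 else 0 := by
  have hs : Function.Surjective (LinearMap.pi α) := by
    rw [← LinearMap.range_eq_top]
    refine Submodule.eq_top_of_finrank_eq ?_
    rw [← (LinearMap.pi α).quotKerEquivRange.finrank_eq, ← iInf_ker_eq_ker_pi]
    exact h.trans (Module.finrank_fintype_fun_eq_card K).symm
  choose w hw using fun j => hs (Pi.single j 1)
  refine ⟨w, fun j k => ?_⟩
  have := congrFun (hw j) k
  rw [LinearMap.pi_apply] at this
  rw [this, Pi.single_apply]
  exact if_congr eq_comm rfl rfl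

/-- The projection of `V` onto the common kernel of the forms `α k` along dual vectors `w k`. -/
noncomputable def kerProjPi {J : Type*} [Fintype J] (α : J → Module.Dual K (V K ℓ))
    (w : J → V K ℓ) : V K ℓ →ₗ[K] V K ℓ :=
  LinearMap.id - ∑ k, (α k).smulRight (w k)

theorem kerProjPi_apply {J : Type*} [Fintype J] (α : J → Module.Dual K (V K ℓ))
    (w : J → V K ℓ) (v : V K ℓ) : kerProjPi α w v = v - ∑ k, α k v • w k := by
  simp [kerProjPi]

theorem comp_kerProjPi {J : Type*} [Fintype J] [DecidableEq J] {α : J → Module.Dual K (V K ℓ)}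
    {w : J → V K ℓ} (hw : ∀ j k, α k (w j) = if j = k then 1 else 0) (k : J) :
    α k ∘ₗ kerProjPi α w = 0 := by
  refine LinearMap.ext fun v => ?_
  simp [kerProjPi_apply, hw]

/-- The product of the defining forms of a finite set of hyperplanes. -/
noncomputable def definingPoly (s : Finset (Submodule K (V K ℓ))) : S K ℓ :=
  ∏ L ∈ s, linPoly (form L)

theorem definingPoly_smul_mem_logDer {s : Finset (Submodule K (V K ℓ))}
    (hs : ∀ L ∈ s, IsHyperplane L) (θ : Der K ℓ) :
    definingPoly s • θ ∈ logDer (s : Set (Submodule K (V K ℓ))) := by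
  refine mem_logDer.2 fun α hα => ?_
  refine linPoly_dvd_of_ker_eq (hs _ hα).ker_form ?_
  rw [Derivation.smul_apply, smul_eq_mul]
  exact (Finset.dvd_prod_of_mem (fun L => linPoly (form L)) hα).mul_right _

/-- On the common kernel of the `α k`, the coordinates `G` of the derivations `definingPoly s •
dirDeriv (w j)` satisfy `G F diag(b) = definingPoly s • 1`. The right side has nonzero determinant
because no member of `s` contains that kernel, so `G F` does too, and Cauchy-Binet gives a minor. -/
theorem exists_det_coeff_ne_zero {s : Finset (Submodule K (V K ℓ))}
    (hs : ∀ L ∈ s, IsHyperplane L) {ι J : Type*} [Fintype ι] [Fintype J] [DecidableEq J]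
    [DecidableEq ι]
    (θ : Module.Basis ι (S K ℓ) (logDer (s : Set (Submodule K (V K ℓ)))))
    {α : J → Module.Dual K (V K ℓ)} {w : J → V K ℓ}
    (hw : ∀ j k, α k (w j) = if j = k then 1 else 0)
    (hX : ∀ L ∈ s, ¬ ⨅ k, LinearMap.ker (α k) ≤ L) {b : J → S K ℓ} {F : Matrix ι J (S K ℓ)}
    (hF : ∀ i k, linPoly (α k) ∣ (θ i : Der K ℓ) (linPoly (α k)) - F i k * b k) :
    ∃ ρ : J → ι, (F.submatrix ρ id).det ≠ 0 := by
  set φ := pullback (kerProjPi α w) with hφ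
  have hφα : ∀ k, φ (linPoly (α k)) = 0 := fun k => by
    rw [hφ, pullback_linPoly, comp_kerProjPi hw, linPoly_zero]
  have hφQ : φ (definingPoly s) ≠ 0 := by
    rw [definingPoly, map_prod, Finset.prod_ne_zero_iff]
    intro L hL h0
    rw [hφ, pullback_linPoly, linPoly_eq_zero] at h0
    refine hX L hL fun x hx => ?_
    rw [Submodule.mem_iInf] at hx
    have hx' : kerProjPi α w x = x := by
      rw [kerProjPi_apply, sub_eq_self]
      exact Finset.sum_eq_zero fun k _ => by rw [LinearMap.mem_ker.1 (hx k), zero_smul]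
    rw [← (hs L hL).ker_form, LinearMap.mem_ker, ← hx']
    exact DFunLike.congr_fun h0 x
  set G : Matrix J ι (S K ℓ) := fun j i =>
    θ.repr ⟨_, definingPoly_smul_mem_logDer hs (dirDeriv (w j))⟩ i with hG
  have hGθ : ∀ j k, ∑ i, G j i * (θ i : Der K ℓ) (linPoly (α k)) =
      definingPoly s * if j = k then 1 else 0 := fun j k => by
    have h1 := congrArg (fun x : logDer (s : Set (Submodule K (V K ℓ))) =>
      (x : Der K ℓ) (linPoly (α k)))
      (θ.sum_repr ⟨_, definingPoly_smul_mem_logDer hs (dirDeriv (w j))⟩)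
    simp only [coe_sum_smul_apply, Derivation.smul_apply, smul_eq_mul, dirDeriv_linPoly,
      hw] at h1
    refine h1.trans ?_
    split_ifs <;> simp
  have hFφ : ∀ i k, φ ((θ i : Der K ℓ) (linPoly (α k))) = φ (F i k) * φ (b k) := fun i k => by
    have h1 := map_dvd φ (hF i k)
    rwa [hφα, zero_dvd_iff, map_sub, map_mul, sub_eq_zero] at h1
  have hmul : G.map φ * F.map φ * Matrix.diagonal (fun k => φ (b k)) =
      φ (definingPoly s) • (1 : Matrix J J (S K ℓ)) := by
    ext1 j k
    rw [Matrix.mul_diagonal, Matrix.mul_apply, Finset.sum_mul, Matrix.smul_apply, smul_eq_mul,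
      Matrix.one_apply]
    have h1 := congrArg φ (hGθ j k)
    rw [map_sum, map_mul, apply_ite φ, map_one, map_zero] at h1
    rw [← h1]
    refine Finset.sum_congr rfl fun i _ => ?_
    rw [map_mul, hFφ, Matrix.map_apply, Matrix.map_apply, mul_assoc]
  have hdet : (G.map φ * F.map φ).det ≠ 0 := fun h0 => by
    have h1 := congrArg Matrix.det hmul
    rw [Matrix.det_mul, h0, zero_mul, Matrix.det_smul, Matrix.det_one, mul_one] at h1
    exact pow_ne_zero _ hφQ h1.symm
  obtain ⟨ρ, hρ⟩ := exists_det_submatrix_ne_zero hdet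
  -- The minor is nonzero after applying the ring homomorphism `φ`, hence already before.
  refine ⟨ρ, fun h0 => hρ ?_⟩
  have h1 := congrArg φ h0
  rwa [map_zero, AlgHom.map_det] at h1

/-- Reindexing so that the rows of a nonvanishing minor are the last ones. -/
theorem exists_perm_det_ne_zero {q : ℕ} {d : Fin ℓ → ℕ} (hd : Monotone d)
    {F : Matrix (Fin ℓ) {j : Fin ℓ // q ≤ (j : ℕ) + 1} (S K ℓ)}
    (hF : ∀ i (k : {j : Fin ℓ // q ≤ (j : ℕ) + 1}), IsHomZ (F i k) ((d i : ℤ) - d k))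
    {ρ : {j : Fin ℓ // q ≤ (j : ℕ) + 1} → Fin ℓ} (hρ : (F.submatrix ρ id).det ≠ 0) :
    ∃ π : Equiv.Perm (Fin ℓ), (∀ i, d (π i) = d i) ∧
      (F.submatrix (fun j : {j : Fin ℓ // q ≤ (j : ℕ) + 1} => π j) id).det ≠ 0 := by
  have hρi : Function.Injective ρ := fun i j hij => by
    by_contra hne
    exact hρ (Matrix.det_zero_of_row_eq hne (by ext1 k; simp [hij]))
  obtain ⟨π, hπ⟩ : ∃ π : Equiv.Perm {j : Fin ℓ // q ≤ (j : ℕ) + 1},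
      ∏ j, F (ρ (π j)) j ≠ 0 := by
    by_contra! h0
    refine hρ ?_
    rw [Matrix.det_apply]
    exact Finset.sum_eq_zero fun π _ => (congrArg _ (h0 π)).trans (smul_zero _)
  rw [Finset.prod_ne_zero_iff] at hπ
  have hτi : Function.Injective fun j => ρ (π j) := hρi.comp π.injective
  -- The entries in a nonzero Leibniz term are nonzero, so their degrees `d (ρ (π j)) - d j` are
  -- nonnegative.
  have hτ := apply_eq_of_injective_of_le hd hτi fun j => by
    have := (hF _ _).nonneg (hπ j (Finset.mem_univ j))
    omega
  obtain ⟨σ, hσ, hσd⟩ := exists_perm_extend (p := fun j : Fin ℓ => q ≤ (j : ℕ) + 1) d _ hτi hτ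
  refine ⟨σ, hσd, ?_⟩
  have h1 : F.submatrix (fun j : {j : Fin ℓ // q ≤ (j : ℕ) + 1} => σ j) id =
      (F.submatrix ρ id).submatrix π id := by
    ext1 i j
    simp [hσ]
  rw [h1, Matrix.det_permute]
  refine mul_ne_zero ?_ hρ
  rcases Int.units_eq_one_or (Equiv.Perm.sign π) with h2 | h2 <;> simp [h2]

/-! ### The adapted basis. -/

/-- The change of basis given by a matrix with an invertible block. -/
theorem exists_basis_of_block {ι R M : Type*} [Fintype ι] [DecidableEq ι] [CommRing R]
    [Nontrivial R] [AddCommGroup M] [Module R M] (θ : Module.Basis ι R M) (p : ι → Prop)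
    [DecidablePred p] (F : ι → {i // p i} → R) (G : Matrix {i // p i} {i // p i} R)
    (hFG : (Matrix.of fun j k : {i // p i} => F j k) * G = 1) :
    ∃ e : Module.Basis ι R M, (∀ j : {i // p i}, e j = ∑ k, G j k • θ k) ∧
      ∀ i, ¬ p i → e i = θ i - ∑ j, F i j • e j := by
  set η : {i // p i} → M := fun j => ∑ k, G j k • θ k with hη
  set v : ι → M := fun i => if h : p i then η ⟨i, h⟩ else θ i - ∑ j, F i j • η j with hv
  have hvη : ∀ j : {i // p i}, v j = η j := fun j => dif_pos j.2
  have hvn : ∀ i, ¬ p i → v i = θ i - ∑ j, F i j • η j := fun i h => dif_neg h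
  have hηspan : ∀ j, η j ∈ Submodule.span R (Set.range v) := fun j =>
    Submodule.subset_span ⟨j, hvη j⟩
  have hspan : ∀ i, θ i ∈ Submodule.span R (Set.range v) := fun i => by
    by_cases h : p i
    -- For `i` in the block, `F G = 1` recovers `θ i` from the `η j`.
    · have h1 : θ i = ∑ j, F i j • η j := by
        have h2 : ∀ k : {i // p i}, ∑ j, F i j * G j k = if ⟨i, h⟩ = k then 1 else 0 := fun k => by
          rw [← Matrix.one_apply, ← hFG, Matrix.mul_apply]; rfl
        simp only [hη, Finset.smul_sum, smul_smul]
        rw [Finset.sum_comm]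
        simp only [← Finset.sum_smul, h2]
        simp
      rw [h1]
      exact Submodule.sum_mem _ fun j _ => Submodule.smul_mem _ _ (hηspan j)
    · rw [← sub_add_cancel (θ i) (∑ j, F i j • η j), ← hvn i h]
      exact add_mem (Submodule.subset_span ⟨i, rfl⟩)
        (Submodule.sum_mem _ fun j _ => Submodule.smul_mem _ _ (hηspan j))
  obtain ⟨e, he⟩ := exists_basis_eq_of_mem_span θ v hspan
  refine ⟨e, fun j => by rw [he, hvη], fun i h => ?_⟩
  rw [he, hvn i h]
  simp only [hvη]

/-- A homogeneous basis of `D(A)` that is dual to the forms `α k`, up to the factors `b k`. -/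
theorem exists_adapted_basis {A : Set (Submodule K (V K ℓ))} (hA : IsArrangement A)
    {d : Fin ℓ → ℕ} (hd : Monotone d) {q : ℕ} (hfree : IsFreeWithExponents A d)
    {α : {j : Fin ℓ // q ≤ (j : ℕ) + 1} → Module.Dual K (V K ℓ)}
    {w : {j : Fin ℓ // q ≤ (j : ℕ) + 1} → V K ℓ}
    (hw : ∀ j k, α k (w j) = if j = k then 1 else 0)
    (hX : ∀ L ∈ A, ¬ ⨅ k, LinearMap.ker (α k) ≤ L)
    {b : {j : Fin ℓ // q ≤ (j : ℕ) + 1} → S K ℓ}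
    (hb : ∀ k : {j : Fin ℓ // q ≤ (j : ℕ) + 1}, (b k).IsHomogeneous (d k))
    (hαb : ∀ k, ∀ θ ∈ logDer A, ∃ f : S K ℓ, linPoly (α k) ∣ θ (linPoly (α k)) - f * b k) :
    ∃ e : Module.Basis (Fin ℓ) (S K ℓ) (logDer A),
      (∀ i, IsHomogeneousDer (e i : Der K ℓ) (d i)) ∧
      ∀ (i : Fin ℓ) (k : {j : Fin ℓ // q ≤ (j : ℕ) + 1}),
        linPoly (α k) ∣ (e i : Der K ℓ) (linPoly (α k)) - (if i = k then 1 else 0) * b k := by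
  obtain ⟨θ₀, hθ₀⟩ := hfree
  choose F₀ hF₀ hF₀b using fun i (k : {j : Fin ℓ // q ≤ (j : ℕ) + 1}) =>
    exists_homogeneous_coeff (hθ₀ i) (hb k) (hαb k _ (θ₀ i).2)
  obtain ⟨ρ, hρ⟩ : ∃ ρ, ((Matrix.of F₀).submatrix ρ id).det ≠ 0 := by
    obtain ⟨s, rfl⟩ := hA.finite.exists_finset_coe
    exact exists_det_coeff_ne_zero hA.isHyperplane θ₀ hw hX hF₀b
  obtain ⟨π, hπd, hπ⟩ := exists_perm_det_ne_zero hd hF₀ hρ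
  set θ := θ₀.reindex π.symm with hθdef
  have hθa : ∀ i, θ i = θ₀ (π i) := fun i => by simp [hθdef]
  have hθ : ∀ i, IsHomogeneousDer (θ i : Der K ℓ) (d i) := fun i => by
    rw [hθa, ← hπd]; exact hθ₀ _
  set F : Fin ℓ → {j : Fin ℓ // q ≤ (j : ℕ) + 1} → S K ℓ := fun i => F₀ (π i) with hFdef
  have hF : ∀ i (k : {j : Fin ℓ // q ≤ (j : ℕ) + 1}), IsHomZ (F i k) ((d i : ℤ) - d k) :=
    fun i k => by rw [← hπd i]; exact hF₀ _ _
  have hFb : ∀ i k, linPoly (α k) ∣ (θ i : Der K ℓ) (linPoly (α k)) - F i k * b k :=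
    fun i k => by rw [hθa]; exact hF₀b _ _
  obtain ⟨G, hGF, hFG, hG⟩ := exists_graded_inverse
    (F := Matrix.of fun j k : {j : Fin ℓ // q ≤ (j : ℕ) + 1} => F j k)
    (d := fun j => (d j : ℤ)) (fun i j => hF i j) hπ
  obtain ⟨e, heη, hen⟩ := exists_basis_of_block (R := S K ℓ) (M := logDer A) θ (fun j : Fin ℓ => q ≤ (j : ℕ) + 1) F G hFG
  have hηv : ∀ (j : {j : Fin ℓ // q ≤ (j : ℕ) + 1}) β, (e j : Der K ℓ) (linPoly β) =
      ∑ k, G j k * (θ k : Der K ℓ) (linPoly β) := fun j β => by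
    rw [heη, coe_sum_smul_apply]
  have hηd : ∀ j : {j : Fin ℓ // q ≤ (j : ℕ) + 1}, IsHomogeneousDer (e j : Der K ℓ) (d j) :=
    fun j => isHomogeneousDer_iff.2 fun β => by
      rw [hηv]
      refine IsHomZ.sum fun k _ => ?_
      have := (hG j k).mul (isHomogeneousDer_iff.1 (hθ k) β)
      rwa [sub_add_cancel] at this
  have hηb : ∀ j k : {j : Fin ℓ // q ≤ (j : ℕ) + 1}, linPoly (α k) ∣
      (e j : Der K ℓ) (linPoly (α k)) - (if j = k then 1 else 0) * b k := fun j k => by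
    have h1 : (if j = k then 1 else 0 : S K ℓ) = ∑ i, G j i * F i k := by
      rw [← Matrix.one_apply, ← hGF, Matrix.mul_apply]; rfl
    rw [hηv, h1, Finset.sum_mul, ← Finset.sum_sub_distrib]
    refine Finset.dvd_sum fun i _ => ?_
    rw [mul_assoc, ← mul_sub]
    exact (hFb i k).mul_left _
  have hv : ∀ i : Fin ℓ, ¬ q ≤ (i : ℕ) + 1 → ∀ β, (e i : Der K ℓ) (linPoly β) =
      (θ i : Der K ℓ) (linPoly β) - ∑ j, F i j * (e j : Der K ℓ) (linPoly β) :=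
    fun i h β => by
      rw [hen i h, Submodule.coe_sub, Derivation.sub_apply, coe_sum_smul_apply]
  refine ⟨e, fun i => ?_, fun i k => ?_⟩
  · by_cases h : q ≤ (i : ℕ) + 1
    · exact hηd ⟨i, h⟩
    · refine isHomogeneousDer_iff.2 fun β => ?_
      rw [hv i h]
      refine (isHomogeneousDer_iff.1 (hθ i) β).sub (IsHomZ.sum fun j _ => ?_)
      have := (hF i j).mul (isHomogeneousDer_iff.1 (hηd j) β)
      rwa [sub_add_cancel] at this
  · by_cases h : q ≤ (i : ℕ) + 1
    · simpa only [Subtype.ext_iff] using hηb ⟨i, h⟩ k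
    · have hik : i ≠ k := fun hik => h (hik ▸ k.2)
      rw [if_neg hik, zero_mul, sub_zero, hv i h]
      -- Modulo `α k` only the summand `j = k` survives, and it is `F i k * b k`, exactly the
      -- residue of `θ i (α k)`.
      have h1 : (θ i : Der K ℓ) (linPoly (α k)) -
            ∑ j, F i j * (e j : Der K ℓ) (linPoly (α k)) =
          ((θ i : Der K ℓ) (linPoly (α k)) - F i k * b k) -
            ∑ j, F i j * ((e j : Der K ℓ) (linPoly (α k)) - (if j = k then 1 else 0) * b k) := by
        simp only [mul_sub, Finset.sum_sub_distrib, ite_mul, one_mul, zero_mul, mul_ite, mul_zero,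
          Finset.sum_ite_eq', Finset.mem_univ, if_true]
        ring
      rw [h1]
      exact dvd_sub (hFb i k) (Finset.dvd_sum fun j _ => (hηb j k).mul_left _)

/-! ### Coordinates in an adapted basis, and the Euler derivation. -/

/-- If membership in `N' ≤ N` amounts to divisibility of the coordinates with respect to a basis of
`N`, then the rescaled basis is a basis of `N'`. -/
theorem exists_basis_smul {ι R M : Type*} [Fintype ι] [CommRing R] [IsDomain R] [AddCommGroup M]
    [Module R M] {N N' : Submodule R M} (hN : N' ≤ N) (e : Module.Basis ι R N) {m : ι → R}
    (hm : ∀ i, m i ≠ 0) (hmem : ∀ i, m i • (e i : M) ∈ N')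
    (h : ∀ x : N, (x : M) ∈ N' → ∀ i, m i ∣ e.repr x i) :
    ∃ e' : Module.Basis ι R N', ∀ i, (e' i : M) = m i • (e i : M) := by
  set v : ι → N' := fun i => ⟨m i • (e i : M), hmem i⟩ with hv
  have hli : LinearIndependent R v := by
    rw [Fintype.linearIndependent_iff]
    intro g hg i
    have h1 : ∑ i, (g i * m i) • e i = 0 := by
      have h2 := congrArg (Subtype.val : N' → M) hg
      apply Subtype.ext
      simpa [hv, smul_smul] using h2
    have h2 := Fintype.linearIndependent_iff.1 e.linearIndependent _ h1 i
    exact (mul_eq_zero.1 h2).resolve_right (hm i)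
  have hspan : ⊤ ≤ Submodule.span R (Set.range v) := by
    rintro ⟨x, hx⟩ -
    choose c hc using h ⟨x, hN hx⟩ hx
    have h1 : (⟨x, hx⟩ : N') = ∑ i, c i • v i := by
      apply Subtype.ext
      have h2 := congrArg (Subtype.val : N → M) (e.sum_repr ⟨x, hN hx⟩)
      simp only [hc] at h2
      refine h2.symm.trans ?_
      simp [hv, smul_smul, mul_comm]
    rw [h1]
    exact Submodule.sum_mem _ fun i _ => Submodule.smul_mem _ _ (Submodule.subset_span ⟨i, rfl⟩)
  exact ⟨Module.Basis.mk hli hspan, fun i => by rw [Module.Basis.mk_apply]⟩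

/-- A basis element can be exchanged for an element whose coordinate there is a unit. -/
theorem exists_basis_update {ι R M : Type*} [Fintype ι] [DecidableEq ι] [CommRing R] [Nontrivial R]
    [AddCommGroup M] [Module R M] (e : Module.Basis ι R M) (v : M) (i : ι)
    (h : IsUnit (e.repr v i)) :
    ∃ e' : Module.Basis ι R M, ⇑e' = Function.update e i v := by
  refine exists_basis_eq_of_mem_span e _ fun j => ?_
  have hne : ∀ j, j ≠ i → e j ∈ Submodule.span R (Set.range (Function.update e i v)) :=
    fun j hj => Submodule.subset_span ⟨j, Function.update_of_ne hj _ _⟩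
  rcases eq_or_ne j i with rfl | hj
  · obtain ⟨c, hc⟩ := h.exists_left_inv
    have h1 : e j = c • (v - ∑ k ∈ Finset.univ.erase j, e.repr v k • e k) := by
      have h2 := e.sum_repr v
      rw [← Finset.add_sum_erase _ _ (Finset.mem_univ j)] at h2
      rw [← eq_sub_of_add_eq h2, smul_smul, hc, one_smul]
    rw [h1]
    refine Submodule.smul_mem _ _ (sub_mem (Submodule.subset_span ⟨j, Function.update_self ..⟩)
      (Submodule.sum_mem _ fun k hk => Submodule.smul_mem _ _ (hne k (Finset.ne_of_mem_erase hk))))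
  · exact hne j hj

/-- Modulo `α k`, the value `θ (α k)` is the `k`-th coordinate of `θ` times `b k`, and the prime `α
k` does not divide `b k`. -/
theorem dvd_repr_of_adapted {A : Set (Submodule K (V K ℓ))} {p : Fin ℓ → Prop}
    {α : {j // p j} → Module.Dual K (V K ℓ)} (hα : ∀ k, α k ≠ 0) {b : {j // p j} → S K ℓ}
    (hb : ∀ k, ¬ linPoly (α k) ∣ b k) (e : Module.Basis (Fin ℓ) (S K ℓ) (logDer A))
    (he : ∀ (i : Fin ℓ) (k : {j // p j}),
      linPoly (α k) ∣ (e i : Der K ℓ) (linPoly (α k)) - (if i = k then 1 else 0) * b k)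
    (θ : logDer A) (k : {j // p j}) (hθ : linPoly (α k) ∣ (θ : Der K ℓ) (linPoly (α k))) :
    linPoly (α k) ∣ e.repr θ k := by
  have h1 : linPoly (α k) ∣ ∑ i, e.repr θ i *
      ((e i : Der K ℓ) (linPoly (α k)) - (if i = k then 1 else 0) * b k) :=
    Finset.dvd_sum fun i _ => (he i k).mul_left _
  have h2 : (θ : Der K ℓ) (linPoly (α k)) =
      ∑ i, e.repr θ i * (e i : Der K ℓ) (linPoly (α k)) := by
    conv_lhs => rw [← e.sum_repr θ]
    rw [coe_sum_smul_apply]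
  simp only [mul_sub, Finset.sum_sub_distrib, ite_mul, one_mul, zero_mul, mul_ite, mul_zero,
    Finset.sum_ite_eq', Finset.mem_univ, if_true, ← h2] at h1
  have h3 := dvd_sub hθ h1
  rw [sub_sub_cancel] at h3
  exact ((prime_linPoly (hα k)).dvd_or_dvd h3).resolve_right (hb k)

/-- In a homogeneous basis of positive degrees, the coordinates of the Euler derivation are
constants, supported in degree one. -/
theorem repr_euler {A : Set (Submodule K (V K ℓ))} (e : Module.Basis (Fin ℓ) (S K ℓ) (logDer A))
    {d : Fin ℓ → ℕ} (hd : ∀ i, 1 ≤ d i) (he : ∀ i, IsHomogeneousDer (e i : Der K ℓ) (d i))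
    (i : Fin ℓ) :
    ∃ c : K, e.repr ⟨euler K ℓ, euler_mem_logDer A⟩ i = C c ∧ (c ≠ 0 → d i = 1) := by
  set g := e.repr ⟨euler K ℓ, euler_mem_logDer A⟩ with hg
  -- The degree one part of the expansion is again an expansion of the Euler derivation. By
  -- uniqueness each coordinate is homogeneous of degree `1 - d i`, which is negative unless `d i =
  -- 1`.
  have h1 : (⟨euler K ℓ, euler_mem_logDer A⟩ : logDer A) =
      ∑ i, compZ (1 - d i : ℤ) (g i) • e i := by
    apply Subtype.ext
    refine der_ext fun β => ?_
    rw [coe_sum_smul_apply]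
    have h2 : euler K ℓ (linPoly β) = ∑ i, g i * (e i : Der K ℓ) (linPoly β) := by
      rw [← coe_sum_smul_apply, hg, e.sum_repr]
    have h3 : IsHomZ (euler K ℓ (linPoly β)) 1 := by
      rw [euler_linPoly]
      exact_mod_cast isHomZ_natCast.2 (isHomogeneous_linPoly β)
    have h4 := congrArg (compZ 1) h2
    rw [h3.compZ_eq, compZ_sum] at h4
    refine h4.trans (Finset.sum_congr rfl fun i _ => ?_)
    exact compZ_mul (isHomogeneousDer_iff.1 (he i) β) 1
  have h2 : g i = compZ (1 - d i : ℤ) (g i) := by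
    conv_lhs => rw [hg, h1, e.repr_sum_self]
  have h3 : IsHomZ (g i) (1 - d i : ℤ) := h2 ▸ isHomZ_compZ _ _
  by_cases hi : d i = 1
  · rw [hi] at h3
    have h4 : (g i).IsHomogeneous 0 := isHomZ_natCast.1 (by simpa using h3)
    rw [← totalDegree_zero_iff_isHomogeneous, totalDegree_eq_zero_iff_eq_C] at h4
    exact ⟨_, h4, fun _ => hi⟩
  · refine ⟨0, ?_, fun h => absurd rfl h⟩
    rw [C_0]
    by_contra h0
    have := h3.nonneg h0
    have := hd i
    omega

theorem euler_ne_zero (hℓ : 0 < ℓ) : euler K ℓ ≠ 0 := fun h => by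
  have := DFunLike.congr_fun h (X ⟨0, hℓ⟩)
  rw [euler, mkDerivation_X] at this
  exact X_ne_zero _ this

/-- The Euler derivation can be made the first member of an adapted basis. -/
theorem exists_adapted_basis_euler {A : Set (Submodule K (V K ℓ))} {q : ℕ} (hℓ : 0 < ℓ)
    (hq : 2 ≤ q)
    {α : {j : Fin ℓ // q ≤ (j : ℕ) + 1} → Module.Dual K (V K ℓ)} (hα : ∀ k, α k ≠ 0)
    {b : {j : Fin ℓ // q ≤ (j : ℕ) + 1} → S K ℓ} (hb : ∀ k, ¬ linPoly (α k) ∣ b k)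
    {d : Fin ℓ → ℕ} (hd : ∀ i, 1 ≤ d i) (hd₁ : d ⟨0, hℓ⟩ = 1)
    (e : Module.Basis (Fin ℓ) (S K ℓ) (logDer A))
    (he : ∀ i, IsHomogeneousDer (e i : Der K ℓ) (d i))
    (heb : ∀ (i : Fin ℓ) (k : {j : Fin ℓ // q ≤ (j : ℕ) + 1}),
      linPoly (α k) ∣ (e i : Der K ℓ) (linPoly (α k)) - (if i = k then 1 else 0) * b k) :
    ∃ e' : Module.Basis (Fin ℓ) (S K ℓ) (logDer A),
      (e' ⟨0, hℓ⟩ : Der K ℓ) = euler K ℓ ∧ (∀ i, IsHomogeneousDer (e' i : Der K ℓ) (d i)) ∧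
      ∀ (i : Fin ℓ) (k : {j : Fin ℓ // q ≤ (j : ℕ) + 1}), i ≠ k →
        linPoly (α k) ∣ (e' i : Der K ℓ) (linPoly (α k)) := by
  set E : logDer A := ⟨euler K ℓ, euler_mem_logDer A⟩ with hE
  set o : Fin ℓ := ⟨0, hℓ⟩ with ho
  obtain ⟨i₀, hi₀⟩ : ∃ i, e.repr E i ≠ 0 := by
    by_contra! h0
    have : E = 0 := e.repr.injective (by ext1 i; simpa using h0 i)
    exact euler_ne_zero hℓ (congrArg Subtype.val this)
  obtain ⟨c, hc, hc1⟩ := repr_euler e hd he i₀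
  rw [← hE] at hc
  have hc0 : c ≠ 0 := fun h => hi₀ (by rw [hc, h, C_0])
  have hu : IsUnit (e.repr E i₀) := hc ▸ (isUnit_iff_ne_zero.2 hc0).map C
  -- The Euler derivation is tangent to every hyperplane, so at a top index its coordinate is
  -- divisible by `α k` and cannot be a unit.
  have hi₀q : ¬ q ≤ (i₀ : ℕ) + 1 := fun h => by
    have h1 := dvd_repr_of_adapted hα hb e heb E ⟨i₀, h⟩ (by
      rw [hE, euler_linPoly])
    exact (prime_linPoly (hα ⟨i₀, h⟩)).not_isUnit (isUnit_of_dvd_unit h1 hu)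
  -- Swapping `i₀` with the first index disturbs neither the degrees, since both are one, nor the
  -- top indices, since `2 ≤ q` keeps the first index out of them.
  obtain ⟨e', he'⟩ := exists_basis_update (e.reindex (Equiv.swap o i₀)) E o (by simpa using hu)
  have he'o : e' o = E := by rw [he', Function.update_self]
  have he'n : ∀ i, i ≠ o → e' i = e (Equiv.swap o i₀ i) := fun i hi => by
    rw [he', Function.update_of_ne hi]; simp
  have hdi₀ : d i₀ = 1 := hc1 hc0
  have hdswap : ∀ i, d (Equiv.swap o i₀ i) = d i := fun i => by
    rw [Equiv.swap_apply_def]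
    split_ifs with h1 h2
    · rw [h1, hdi₀, hd₁]
    · rw [h2, hdi₀, hd₁]
    · rfl
  refine ⟨e', by rw [he'o], fun i => ?_, fun i k hik => ?_⟩
  · rcases eq_or_ne i o with rfl | hi
    · rw [he'o, hd₁]
      exact fun β => (euler_linPoly β).symm ▸ isHomogeneous_linPoly β
    · rw [he'n i hi, ← hdswap]
      exact he _
  · rcases eq_or_ne i o with rfl | hi
    · rw [he'o]
      rw [hE, euler_linPoly]
    · have hk : Equiv.swap o i₀ k = k := by
        refine Equiv.swap_apply_of_ne_of_ne (fun h => ?_) fun h => hi₀q (h ▸ k.2)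
        have h1 := k.2
        rw [h, ho] at h1
        simp at h1
        omega
      have h1 : Equiv.swap o i₀ i ≠ k := fun h => hik (by
        rw [← hk] at h
        exact (Equiv.swap o i₀).injective h)
      have h2 := heb (Equiv.swap o i₀ i) k
      rw [if_neg h1, zero_mul, sub_zero] at h2
      rwa [he'n i hi]

/-! ### Assembling the theorem. -/

/-- The arrangement `B` will be either `A' ∪ {H_q, …, H_ℓ}` or this with one `H j` removed. -/
theorem mem_logDer_of_subset_union {A B : Set (Submodule K (V K ℓ))} {p : Fin ℓ → Prop}
    {H : Fin ℓ → Submodule K (V K ℓ)} (hH : ∀ j, p j → IsHyperplane (H j))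
    (hB : B ⊆ A ∪ H '' {j | p j}) {θ : Der K ℓ} (hθ : θ ∈ logDer A)
    (h : ∀ j, p j → H j ∈ B → linPoly (form (H j)) ∣ θ (linPoly (form (H j)))) :
    θ ∈ logDer B := by
  refine mem_logDer.2 fun β hβ => ?_
  rcases hB hβ with hA | ⟨j, hj, hjβ⟩
  · exact mem_logDer.1 hθ β hA
  · refine linPoly_dvd_of_ker_eq ?_ (h j hj (hjβ ▸ hβ))
    rw [(hH j hj).ker_form, hjβ]

theorem card_subtype_le_add_one {ℓ q : ℕ} (hq : 1 ≤ q) (hqℓ : q ≤ ℓ) :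
    Fintype.card {j : Fin ℓ // q ≤ (j : ℕ) + 1} = ℓ - q + 1 := by
  have h1 : (Finset.univ.filter fun j : Fin ℓ => q ≤ (j : ℕ) + 1) =
      Finset.Ici ⟨q - 1, by omega⟩ := by
    ext j
    rw [Finset.mem_filter_univ, Finset.mem_Ici, Fin.le_def]
    exact Nat.sub_le_iff_le_add.symm
  rw [Fintype.card_subtype, h1, Fin.card_Ici]
  simp only
  omega

end HypArr

open HypArr

/-- Indices: the element `i : Fin ℓ` stands for the (one-based) index `i + 1 ∈ {1, …, ℓ}`, so that
`q ≤ j + 1` says that `j` stands for one of the indices `q, …, ℓ`. Only these values of `H` are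
used. -/
theorem theorem1p4 {K : Type*} [Field K] (ℓ q : ℕ) (hq : 2 ≤ q) (hqℓ : q ≤ ℓ)
    (A' A : Set (Submodule K (HypArr.V K ℓ))) (hA' : HypArr.IsArrangement A')
    (d : Fin ℓ → ℕ) (hd : Monotone d) (hd₁ : d ⟨0, by omega⟩ = 1)
    (hfree : HypArr.IsFreeWithExponents A' d)
    (H : Fin ℓ → Submodule K (HypArr.V K ℓ))
    (hH : ∀ j : Fin ℓ, q ≤ (j : ℕ) + 1 → HypArr.IsHyperplane (H j))
    (hA : A = A' ∪ H '' {j : Fin ℓ | q ≤ (j : ℕ) + 1})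
    (h₁ : ∀ j : Fin ℓ, q ≤ (j : ℕ) + 1 →
      (A'.ncard : ℤ) - ((HypArr.restriction (A' ∪ {H j}) (H j)).ncard : ℤ) = (d j : ℤ))
    (X : Submodule K (HypArr.V K ℓ))
    (hX : X = ⨅ (j : Fin ℓ) (_ : q ≤ (j : ℕ) + 1), H j)
    (h₂ : HypArr.codim X = ℓ - q + 1)
    (h₃ : ∀ L ∈ A', ¬ X ≤ L) :
    HypArr.IsFreeWithExponents A
        (fun i : Fin ℓ => if q ≤ (i : ℕ) + 1 then d i + 1 else d i) ∧
      ∃ b : Module.Basis (Fin ℓ) (HypArr.S K ℓ) (HypArr.logDer A'),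
        (b ⟨0, by omega⟩ : HypArr.Der K ℓ) = HypArr.euler K ℓ ∧
        (∀ i : Fin ℓ, HypArr.IsHomogeneousDer (b i : HypArr.Der K ℓ) (d i)) ∧
        (∀ i : Fin ℓ, (i : ℕ) + 1 < q → (b i : HypArr.Der K ℓ) ∈ HypArr.logDer A) ∧
        (∀ j : Fin ℓ, q ≤ (j : ℕ) + 1 →
          (b j : HypArr.Der K ℓ) ∈ HypArr.logDer (A \ {H j})) := by
  have hℓ : 0 < ℓ := by omega
  have hd_pos : ∀ i, 1 ≤ d i := fun i => hd₁ ▸ hd (Fin.mk_le_mk.2 (Nat.zero_le _))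
  set α : {j : Fin ℓ // q ≤ (j : ℕ) + 1} → Module.Dual K (V K ℓ) := fun k => form (H k)
  have hα : ∀ k, α k ≠ 0 := fun k => (hH k k.2).form_ne_zero
  have hker : ∀ k, LinearMap.ker (α k) = H k := fun k => (hH k k.2).ker_form
  have hXα : X = ⨅ k, LinearMap.ker (α k) := by
    simp only [hX, hker]
    exact iInf_subtype'
  -- Each `H k` contains `X`, whereas no member of `A'` does, so the added hyperplanes are new.
  have hkerA : ∀ k, LinearMap.ker (α k) ∉ A' := fun k hk => h₃ _ hk (hXα ▸ iInf_le _ k)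
  obtain ⟨w, hw⟩ := exists_dual_vectors α (by
    rw [← hXα, h₂, card_subtype_le_add_one (by omega) hqℓ])
  choose b hb hαb hbθ using fun k => exists_restriction_polynomial hA' (hα k) (hkerA k)
  have hbd : ∀ k : {j : Fin ℓ // q ≤ (j : ℕ) + 1}, (b k).IsHomogeneous (d k) := fun k => by
    -- The degree of `b k` is a truncated difference; `h₁` shows that the integral difference is `d
    -- k ≥ 0`, so nothing is truncated.
    convert hb k using 1
    have := h₁ k k.2
    rw [hker]
    omega
  obtain ⟨e, hed, heb⟩ := exists_adapted_basis hA' hd hfree hw (hXα ▸ h₃) hbd hbθ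
  have hdvd : ∀ (i : Fin ℓ) (k : {j : Fin ℓ // q ≤ (j : ℕ) + 1}), i ≠ k →
      linPoly (α k) ∣ (e i : Der K ℓ) (linPoly (α k)) := fun i k hik => by
    simpa [hik] using heb i k
  constructor
  -- The scaling factor raises the degree by one exactly at the top indices.
  · set m : Fin ℓ → S K ℓ := fun i =>
      if h : q ≤ (i : ℕ) + 1 then linPoly (α ⟨i, h⟩) else 1 with hm
    have hm_pos : ∀ k : {j : Fin ℓ // q ≤ (j : ℕ) + 1}, m k = linPoly (α k) := fun k => dif_pos k.2
    have hm_neg : ∀ i : Fin ℓ, ¬ q ≤ (i : ℕ) + 1 → m i = 1 := fun i h => dif_neg h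
    obtain ⟨f, hf⟩ := exists_basis_smul (N' := logDer A) (m := m)
      (logDer_anti (hA ▸ Set.subset_union_left)) e (fun i => by
        by_cases h : q ≤ (i : ℕ) + 1
        · rw [hm_pos ⟨i, h⟩]
          exact (prime_linPoly (hα _)).ne_zero
        · rw [hm_neg i h]
          exact one_ne_zero) (fun i => by
        refine mem_logDer_of_subset_union hH hA.subset (Submodule.smul_mem _ _ (e i).2)
          fun j hj _ => ?_
        rw [Derivation.smul_apply, smul_eq_mul]
        rcases eq_or_ne i j with rfl | hij
        · rw [hm_pos ⟨i, hj⟩]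
          exact dvd_mul_right _ _
        · exact (hdvd i ⟨j, hj⟩ hij).mul_left _) (fun θ hθ i => by
        by_cases h : q ≤ (i : ℕ) + 1
        · rw [hm_pos ⟨i, h⟩]
          refine dvd_repr_of_adapted hα hαb e heb θ ⟨i, h⟩ (mem_logDer.1 hθ _ ?_)
          rw [hker, hA]
          exact Or.inr ⟨i, h, rfl⟩
        · rw [hm_neg i h]
          exact one_dvd _)
    refine ⟨f, fun i β => ?_⟩
    rw [hf, Derivation.smul_apply, smul_eq_mul]
    beta_reduce
    by_cases h : q ≤ (i : ℕ) + 1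
    · rw [if_pos h, hm_pos ⟨i, h⟩, add_comm]
      exact (isHomogeneous_linPoly _).mul (hed i β)
    · rw [if_neg h, hm_neg i h, one_mul]
      exact hed i β
  · obtain ⟨e', he'o, he'd, he'⟩ := exists_adapted_basis_euler hℓ hq hα hαb hd_pos hd₁ e hed heb
    refine ⟨e', he'o, he'd, fun i hi => ?_, fun j hj => ?_⟩
    · refine mem_logDer_of_subset_union hH hA.subset (e' i).2 fun k hk _ => he' i ⟨k, hk⟩ ?_
      rintro rfl
      exact absurd hk (by omega)
    · refine mem_logDer_of_subset_union hH (Set.sdiff_subset.trans hA.subset) (e' j).2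
        fun k hk hkj => he' j ⟨k, hk⟩ ?_
      rintro rfl
      exact hkj.2 rfl
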